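/- Theorem 1. Let $N$ be a normal subgroup of a finite group $G$ with $Q=G/N$ abelian, and let $q\in G$. Let $\mathrm{Irr}\,G$ be the set of characters of irreducible complex representations of $G$, and let the character group $\hat Q=\mathrm{Hom}(Q,\mathbb{C}^\times)$ act on it by tensoring, $(\chi\cdot\rho)(g)=\chi(gN)\rho(g)$. Write $[g]$ for the conjugacy class of $g\in G$ and $[\rho]$ for the $\hat Q$-orbit of $\rho\in\mathrm{Irr}\,G$. Let $\mathcal{C}_q$ be the set of conjugacy classes of $G$ contained in the coset $qN$, and let $\mathcal{R}_q$ be the set of $\hat Q$-orbits $[\rho]$ on $\mathrm{Irr}\,G$ with $\rho$ not identically $0$ on $qN$ (this condition does not depend on the choice of $\rho$ in its orbit). Then $\#\mathcal{C}_q=\#\mathcal{R}_q$, and, for every choice of a representative $\rho$ of each orbit in $\mathcal{R}_q$, the matrix $$M_q=\Bigl(\sqrt{\tfrac{\#[g]\,\#[\rho]}{\#G}}\;\rho(g)\Bigr)_{[\rho]\in\mathcal{R}_q,\,[g]\in\mathcal{C}_q}$$ is unitary, that is, $M_qM_q^*=I$ and $M_q^*M_q=I$. -/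

import Mathlib

open scoped Pointwise Matrix

namespace CosetCharacters

/-- `f : G → ℂ` is the character of an irreducible (finite-dimensional) complex representation of
`G`. Every finite-dimensional complex vector space is isomorphic to some `Fin n → ℂ`. -/
def IsIrrChar {G : Type*} [Group G] (f : G → ℂ) : Prop :=
  ∃ (n : ℕ) (ρ : Representation ℂ G (Fin n → ℂ)), ρ.IsIrreducible ∧ ρ.character = f

/-- `Irr G`, the set of irreducible complex characters of `G`. -/
def Irr (G : Type*) [Group G] : Type _ := {f : G → ℂ // IsIrrChar f}

instance {G : Type*} [Group G] : CoeFun (Irr G) (fun _ => G → ℂ) := ⟨Subtype.val⟩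

/-- The character group of `Q = G ⧸ N`. -/
abbrev DualQuotient {G : Type*} [Group G] (N : Subgroup G) [N.Normal] : Type _ :=
  (G ⧸ N) →* ℂˣ

/-- The tensor product of the one-dimensional representation `χ` with `ρ`, realised on the space
of `ρ`. -/
def twist {G V : Type*} [Group G] [AddCommGroup V] [Module ℂ V] (χ : G →* ℂˣ)
    (ρ : Representation ℂ G V) : Representation ℂ G V where
  toFun g := (χ g : ℂ) • ρ g
  map_one' := by simp
  map_mul' g h := by
    ext v
    simp [smul_smul, mul_comm]

theorem twist_character {G V : Type*} [Group G] [AddCommGroup V] [Module ℂ V] (χ : G →* ℂˣ)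
    (ρ : Representation ℂ G V) (g : G) :
    (twist χ ρ).character g = (χ g : ℂ) * ρ.character g := by
  simp [twist, Representation.character]

/-- Twisting does not change which subspaces are stable. -/
def twistSubrepEquiv {G V : Type*} [Group G] [AddCommGroup V] [Module ℂ V] (χ : G →* ℂˣ)
    (ρ : Representation ℂ G V) : Subrepresentation ρ ≃o Subrepresentation (twist χ ρ) where
  toFun W := ⟨W.toSubmodule, fun g _ hv =>
    W.toSubmodule.smul_mem _ (W.apply_mem_toSubmodule g hv)⟩
  invFun W := ⟨W.toSubmodule, fun g v hv => by
    have h := W.toSubmodule.smul_mem ((χ g : ℂ)⁻¹) (W.apply_mem_toSubmodule g hv)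
    simpa [twist, smul_smul] using h⟩
  left_inv _ := rfl
  right_inv _ := rfl
  map_rel_iff' := Iff.rfl

theorem IsIrrChar.twist {G : Type*} [Group G] (χ : G →* ℂˣ) {f : G → ℂ} (hf : IsIrrChar f) :
    IsIrrChar (fun g => (χ g : ℂ) * f g) := by
  obtain ⟨n, ρ, hρ, rfl⟩ := hf
  exact ⟨n, CosetCharacters.twist χ ρ,
    (OrderIso.isSimpleOrder_iff (twistSubrepEquiv χ ρ)).1 hρ,
    funext fun g => twist_character χ ρ g⟩

/-- The character group of `G ⧸ N` acts on `Irr G` by tensoring: `(χ • ρ)(g) = χ(gN) ρ(g)`. -/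
instance {G : Type*} [Group G] (N : Subgroup G) [N.Normal] :
    MulAction (DualQuotient N) (Irr G) where
  smul χ ρ := ⟨fun g => (χ (QuotientGroup.mk' N g) : ℂ) * ρ.1 g,
    ρ.2.twist (χ.comp (QuotientGroup.mk' N))⟩
  one_smul ρ := Subtype.ext (funext fun g => one_mul (ρ.1 g))
  mul_smul χ ψ ρ := Subtype.ext (funext fun g =>
    mul_assoc (χ (QuotientGroup.mk' N g) : ℂ) (ψ (QuotientGroup.mk' N g) : ℂ) (ρ.1 g))

/-- A finite group has finitely many irreducible characters. -/
instance {G : Type*} [Group G] [Finite G] : Finite (Irr G) := by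
  classical
  have : Fintype G := Fintype.ofFinite G
  have hG : (Nat.card G : ℂ) ≠ 0 := Nat.cast_ne_zero.2 Nat.card_pos.ne'
  have : Invertible (Nat.card G : ℂ) := invertibleOfNonzero hG
  have key : ∀ f f' : Irr G,
      (Nat.card G : ℂ)⁻¹ * ∑ g : G, f.1 g * f'.1 g⁻¹ = if f = f' then 1 else 0 := by
    intro f f'
    obtain ⟨n, ρ, hρ, hf⟩ := f.2
    obtain ⟨m, σ, hσ, hf'⟩ := f'.2
    have h := Representation.char_orthonormal ρ σ
    have h1 := Representation.char_orthonormal ρ ρ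
    rw [if_pos ⟨Representation.Equiv.refl ρ⟩, hf] at h1
    by_cases e : f = f'
    · subst e
      rw [if_pos rfl]
      simpa using h1
    · rw [if_neg e]
      rw [if_neg, hf, hf'] at h
      · simpa using h
      · rintro ⟨φ⟩
        exact e (Subtype.ext (by rw [← hf, ← hf', Representation.char_iso φ]))
  have li : LinearIndependent ℂ (fun f : Irr G => f.1) := by
    rw [linearIndependent_iff']
    intro s c hc i hi
    have h0 : (Nat.card G : ℂ)⁻¹ * ∑ g : G, (∑ j ∈ s, c j • j.1) g * i.1 g⁻¹ = 0 := by
      rw [hc]; simp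
    have h1 : (Nat.card G : ℂ)⁻¹ * ∑ g : G, (∑ j ∈ s, c j • j.1) g * i.1 g⁻¹
        = ∑ j ∈ s, c j * ((Nat.card G : ℂ)⁻¹ * ∑ g : G, j.1 g * i.1 g⁻¹) := by
      simp only [Finset.sum_apply, Pi.smul_apply, smul_eq_mul, Finset.sum_mul, Finset.mul_sum]
      rw [Finset.sum_comm]
      exact Finset.sum_congr rfl fun _ _ => Finset.sum_congr rfl fun _ _ => by ring
    rw [h1] at h0
    simp only [key] at h0
    simpa [hi] using h0
  exact li.finite

/-- The conjugacy classes of `G` inside the coset `qN`. -/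
abbrev ClassesIn {G : Type*} [Group G] (N : Subgroup G) (q : G) : Type _ :=
  {c : ConjClasses G // c.carrier ⊆ q • (N : Set G)}

/-- The orbits of the character group of `G ⧸ N` on `Irr G`. -/
abbrev TwistOrbit {G : Type*} [Group G] (N : Subgroup G) [N.Normal] : Type _ :=
  MulAction.orbitRel.Quotient (DualQuotient N) (Irr G)

/-- The orbits `[ρ]` with `ρ` not identically `0` on the coset `qN`
(whether this holds does not depend on the member `ρ` of the orbit). -/
abbrev OrbitsOn {G : Type*} [Group G] (N : Subgroup G) [N.Normal] (q : G) : Type _ :=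
  {o : TwistOrbit N // ∃ ρ ∈ o.orbit, ∃ g ∈ q • (N : Set G), ρ g ≠ 0}

noncomputable instance {G : Type*} [Group G] [Finite G] (N : Subgroup G) (q : G) :
    Fintype (ClassesIn N q) :=
  have : Finite (ConjClasses G) := Finite.of_surjective _ ConjClasses.mk_surjective
  Fintype.ofFinite _

noncomputable instance {G : Type*} [Group G] [Finite G] (N : Subgroup G) [N.Normal] (q : G) :
    Fintype (OrbitsOn N q) :=
  have : Finite (TwistOrbit N) := Quotient.finite _
  Fintype.ofFinite _

/-- The matrix with entries `√(#[g] #[ρ] / #G) ρ(g)`, with rows indexed by the orbits `[ρ]` and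
columns by the classes `[g]`, for given representatives `ρ` of the orbits and `g` of the
classes. -/
noncomputable def cosetMatrix {G : Type*} [Group G] (N : Subgroup G) [N.Normal] (q : G)
    (ρ : OrbitsOn N q → Irr G) (g : ClassesIn N q → G) :
    Matrix (OrbitsOn N q) (ClassesIn N q) ℂ :=
  Matrix.of fun o c =>
    (Real.sqrt ((Nat.card c.1.carrier : ℝ) * (Nat.card o.1.orbit : ℝ) / (Nat.card G : ℝ)) : ℂ)
      * ρ o (g c)

end CosetCharacters

/-!
The character table of `G`, with the column of `[g]` scaled by `√(#[g] / #G)`, is unitary;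
the coset version is obtained by cutting out the columns in `qN` and then discarding redundant rows.

*Columns.* If `gN = hN`, then `ρ(g) conj ρ(h)` does not change when `ρ` is twisted by a character of
`G ⧸ N`, because the values of such a character have absolute value `1`. Hence the second
orthogonality relation `∑_ρ ρ(g) conj ρ(h) = #G / #[g]` or `0` (`Irr.card_carrier_mul_sum`),
collected by orbits, says that the columns of the matrix are orthonormal; orbits vanishing on `qN`
contribute nothing.

*Rows.* Since `G ⧸ N` is abelian, Fourier inversion writes the indicator function of `qN` as a
combination of the characters `χ` of `G ⧸ N`. So the inner product of `ρ` and `σ` over `qN` is a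
combination of the inner products over `G` of the twists `χ • ρ` with `σ` (`sum_coset_mul_conj`).
By the first orthogonality relation it vanishes if `ρ` and `σ` lie in different orbits. If `ρ = σ`,
then only the `χ` in the stabilizer of `ρ` contribute; they are trivial at `q` as soon as `ρ` does
not vanish on `qN`, so by the orbit-stabilizer theorem the inner product is `#G / #[ρ]`.

The matrix thus has a two-sided inverse, and comparing the traces of the two products gives
`#𝓡_q = #𝓒_q`.

The second orthogonality relation rests on the completeness of the irreducible characters
(`eq_zero_of_sum_mul_irr_eq_zero`): a class function with zero pairing against every irreducible
character is a central element of the group algebra which, by Schur's lemma, acts by zero on every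
irreducible representation, hence is zero because the group algebra is semisimple. The relation
`χ(g⁻¹) = conj χ(g)` follows from the existence of an invariant Hermitian form.
-/

namespace CosetCharacters

open scoped MonoidAlgebra ComplexOrder

/-! ### Values and first orthogonality relation -/

theorem character_inv_eq_conj {G : Type*} [Group G] [Finite G] {n : ℕ}
    (ρ : Representation ℂ G (Fin n → ℂ)) (g : G) :
    ρ.character g⁻¹ = starRingEnd ℂ (ρ.character g) := by
  classical
  have := Fintype.ofFinite G
  let A : G →* Matrix (Fin n) (Fin n) ℂ :=
    (LinearMap.toMatrixAlgEquiv' (R := ℂ) (n := Fin n)).toMonoidHom.comp ρ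
  have hA : ∀ g, ρ.character g = (A g).trace := fun g =>
    LinearMap.trace_eq_matrix_trace ℂ (Pi.basisFun ℂ (Fin n)) (ρ g)
  -- The Gram matrix of the Hermitian form averaged over the group, which every `A x` preserves.
  let P : Matrix (Fin n) (Fin n) ℂ := ∑ x, (A x)ᴴ * A x
  have hP : IsUnit P := by
    have h1 : P = (A 1)ᴴ * A 1 + ∑ x ∈ Finset.univ.erase 1, (A x)ᴴ * A x :=
      (Finset.add_sum_erase _ _ (Finset.mem_univ 1)).symm
    rw [h1, map_one, Matrix.conjTranspose_one, one_mul]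
    exact (Matrix.PosDef.one.add_posSemidef
      (Matrix.posSemidef_sum _ fun x _ => Matrix.posSemidef_conjTranspose_mul_self _)).isUnit
  have hinv : (A g)ᴴ * P * A g = P := by
    simp only [P, Finset.mul_sum, Finset.sum_mul]
    refine Fintype.sum_equiv (Equiv.mulRight g) _ _ fun x => ?_
    simp [Matrix.mul_assoc]
  have hgg : A g * A g⁻¹ = 1 := by rw [← map_mul, mul_inv_cancel, map_one]
  have hconj : (A g)ᴴ * P = P * A g⁻¹ := by
    calc (A g)ᴴ * P = (A g)ᴴ * P * (A g * A g⁻¹) := by rw [hgg, mul_one]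
      _ = P * A g⁻¹ := by rw [← mul_assoc, hinv]
  have hPd := (Matrix.isUnit_iff_isUnit_det P).1 hP
  have : (A g)ᴴ = P * A g⁻¹ * P⁻¹ := by
    rw [← hconj, Matrix.mul_assoc, Matrix.mul_nonsing_inv _ hPd, mul_one]
  rw [hA, hA, starRingEnd_apply, ← Matrix.trace_conjTranspose, this, Matrix.trace_mul_comm,
    ← Matrix.mul_assoc, Matrix.nonsing_inv_mul _ hPd, one_mul]

theorem Irr.apply_inv {G : Type*} [Group G] [Finite G] (χ : Irr G) (g : G) :
    χ g⁻¹ = starRingEnd ℂ (χ g) := by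
  obtain ⟨n, ρ, -, hf⟩ := χ.2
  rw [← hf, character_inv_eq_conj]

theorem Irr.apply_eq_of_isConj {G : Type*} [Group G] (χ : Irr G) {g h : G} (hgh : IsConj g h) :
    χ g = χ h := by
  obtain ⟨n, ρ, -, hf⟩ := χ.2
  obtain ⟨c, rfl⟩ := isConj_iff.1 hgh
  rw [← hf, Representation.char_conj]

/-- First orthogonality relation, in the unnormalized form. -/
theorem Irr.sum_mul_conj {G : Type*} [Group G] [Fintype G] [DecidableEq (Irr G)] (χ ψ : Irr G) :
    ∑ g, χ g * starRingEnd ℂ (ψ g) = if χ = ψ then (Nat.card G : ℂ) else 0 := by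
  have hG : (Nat.card G : ℂ) ≠ 0 := Nat.cast_ne_zero.2 Nat.card_pos.ne'
  have : Invertible (Nat.card G : ℂ) := invertibleOfNonzero hG
  obtain ⟨n, ρ, hρ, hf⟩ := χ.2
  obtain ⟨m, σ, hσ, hf'⟩ := ψ.2
  have key : ∑ g, χ g * starRingEnd ℂ (ψ g) = Nat.card G *
      ((Nat.card G : ℂ)⁻¹ * ∑ g, ρ.character g * σ.character g⁻¹) := by
    rw [mul_inv_cancel_left₀ hG]
    simp only [hf, hf', Irr.apply_inv]
  by_cases e : χ = ψ
  · have h1 := Representation.char_orthonormal ρ ρ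
    rw [if_pos ⟨Representation.Equiv.refl ρ⟩] at h1
    have hch : σ.character = ρ.character := by rw [hf, hf', e]
    rw [key, hch, h1, mul_one, if_pos e]
  · rw [key, Representation.char_orthonormal ρ σ, if_neg, mul_zero, if_neg e]
    rintro ⟨φ⟩
    exact e (Subtype.ext (by rw [← hf, ← hf', Representation.char_iso φ]))

/-! ### Completeness and second orthogonality relation -/

/-- A simple module over the group algebra comes from an irreducible representation on a coordinate
space `Fin n → ℂ`, which is the form in which `IsIrrChar` provides irreducible representations. -/
theorem exists_isIrreducible_of_isSimpleModule {G S : Type*} [Group G] [AddCommGroup S]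
    [Module ℂ S] [Module ℂ[G] S] [IsScalarTower ℂ ℂ[G] S] [FiniteDimensional ℂ S]
    [IsSimpleModule ℂ[G] S] :
    ∃ (n : ℕ) (ρ : Representation ℂ G (Fin n → ℂ)) (e : S ≃ₗ[ℂ] (Fin n → ℂ)), ρ.IsIrreducible ∧
      ∀ (z : ℂ[G]) (s : S), ρ.asAlgebraHom z (e s) = e (z • s) := by
  let e : S ≃ₗ[ℂ] (Fin (Module.finrank ℂ S) → ℂ) := (Module.finBasis ℂ S).equivFun
  let φ : ℂ[G] →ₐ[ℂ] Module.End ℂ (Fin (Module.finrank ℂ S) → ℂ) :=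
    (e.conjAlgEquiv ℂ).toAlgHom.comp (Algebra.lsmul ℂ ℂ S)
  let ρ : Representation ℂ G (Fin (Module.finrank ℂ S) → ℂ) := (MonoidAlgebra.lift ℂ _ G).symm φ
  have hρ : ρ.asAlgebraHom = φ := (MonoidAlgebra.lift ℂ _ G).apply_symm_apply φ
  have key : ∀ (z : ℂ[G]) (s : S), ρ.asAlgebraHom z (e s) = e (z • s) := by
    intro z s
    rw [hρ]
    change e (z • e.symm (e s)) = _
    rw [e.symm_apply_apply]
  refine ⟨_, ρ, e, ?_, key⟩
  rw [Representation.irreducible_iff_isSimpleModule_asModule]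
  let E : S ≃ₗ[ℂ[G]] ρ.asModule :=
    { e.toAddEquiv with map_smul' := fun z s => (key z s).symm }
  exact IsSimpleModule.congr E.symm

/-- The group algebra acts faithfully on the irreducible representations: an element killing all of
them annihilates every simple left ideal, and by Maschke's theorem these span the group algebra. -/
theorem eq_zero_of_asAlgebraHom_eq_zero {G : Type*} [Group G] [Finite G] {z : ℂ[G]}
    (hz : ∀ (n : ℕ) (ρ : Representation ℂ G (Fin n → ℂ)), ρ.IsIrreducible →
      ρ.asAlgebraHom z = 0) : z = 0 := by
  have : NeZero (Nat.card G : ℂ) := ⟨Nat.cast_ne_zero.2 Nat.card_pos.ne'⟩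
  have : FiniteDimensional ℂ ℂ[G] := inferInstance
  suffices h : z ∈ Module.annihilator ℂ[G] ℂ[G] by
    simpa using Module.mem_annihilator.1 h 1
  rw [← Submodule.annihilator_top, ← IsSemisimpleModule.sSup_simples_eq_top, sSup_eq_iSup',
    Submodule.annihilator_iSup, Submodule.mem_iInf]
  rintro ⟨S, hS⟩
  have : IsSimpleModule ℂ[G] S := hS
  have : FiniteDimensional ℂ S := FiniteDimensional.finiteDimensional_submodule (S.restrictScalars ℂ)
  obtain ⟨n, ρ, e, hρ, h⟩ := exists_isIrreducible_of_isSimpleModule (G := G) (S := S)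
  refine Module.mem_annihilator.2 fun s => e.injective ?_
  rw [← h, hz n ρ hρ, map_zero, LinearMap.zero_apply]

/-- Completeness of the irreducible characters among the class functions. -/
theorem eq_zero_of_sum_mul_irr_eq_zero {G : Type*} [Group G] [Fintype G] {f : G → ℂ}
    (hf : ∀ g h, IsConj g h → f g = f h) (h0 : ∀ χ : Irr G, ∑ g, f g * χ g = 0) : f = 0 := by
  classical
  let z : ℂ[G] := ∑ g, MonoidAlgebra.single g (f g)
  have hz : z ∈ Submonoid.center ℂ[G] := by
    have hcomm : ∀ x : G, MonoidAlgebra.of ℂ G x * z = z * MonoidAlgebra.of ℂ G x := by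
      intro x
      simp only [z, Finset.mul_sum, Finset.sum_mul, MonoidAlgebra.of_apply,
        MonoidAlgebra.single_mul_single, one_mul, mul_one]
      refine Fintype.sum_equiv (MulAut.conj x).toEquiv _ _ fun g => ?_
      have : f ((MulAut.conj x).toEquiv g) = f g :=
        (hf _ _ (isConj_iff.2 ⟨x, rfl⟩)).symm
      rw [this]
      simp
    rw [Submonoid.mem_center_iff]
    intro y
    induction y using MonoidAlgebra.induction_on with
    | of x => exact hcomm x
    | add a b ha hb => rw [add_mul, mul_add, ha, hb]
    | smul r a ha => rw [smul_mul_assoc, mul_smul_comm, ha]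
  have hz0 : z = 0 := by
    refine eq_zero_of_asAlgebraHom_eq_zero fun n ρ hρ => ?_
    -- By Schur's lemma `z` acts as a scalar, which is zero because its trace is.
    let T := Representation.IntertwiningMap.centralAlgebraMul ρ hz
    obtain ⟨c, hc⟩ :=
      (Representation.IsIrreducible.algebraMap_intertwiningMap_bijective_of_isAlgClosed
        (ρ := ρ)).2 T
    have hT : ρ.asAlgebraHom z = c • LinearMap.id := by
      refine LinearMap.ext fun v => ?_
      have := congrArg (fun F : ρ.IntertwiningMap ρ => F.toLinearMap v) hc
      exact this.symm
    have htr : LinearMap.trace ℂ _ (ρ.asAlgebraHom z) = 0 := by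
      rw [← h0 ⟨_, n, ρ, hρ, rfl⟩]
      simp [z, Representation.character]
    rw [hT, map_smul, LinearMap.trace_id, smul_eq_mul, mul_eq_zero] at htr
    rw [hT]
    rcases htr with rfl | h
    · rw [zero_smul]
    -- The zero space is not irreducible, but on it the claim is trivial.
    · have : n = 0 := by simpa using h
      subst this
      exact Subsingleton.elim _ _
  funext g
  have := congrArg (fun y : ℂ[G] => y.coeff g) hz0
  simpa [z, Finsupp.single_apply] using this

/-- Second orthogonality relation. -/
theorem Irr.card_carrier_mul_sum {G : Type*} [Group G] [Finite G] [Fintype (Irr G)] (g h : G)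
    [Decidable (IsConj g h)] :
    (Nat.card (ConjClasses.mk g).carrier : ℂ) * ∑ χ : Irr G, χ g * starRingEnd ℂ (χ h) =
      if IsConj g h then (Nat.card G : ℂ) else 0 := by
  classical
  have := Fintype.ofFinite G
  let f : G → ℂ := fun x => (Nat.card (ConjClasses.mk g).carrier : ℂ) *
      (∑ χ : Irr G, χ g * starRingEnd ℂ (χ x)) - if IsConj g x then (Nat.card G : ℂ) else 0
  -- `f` is a class function orthogonal to every irreducible character.
  suffices hf : f = 0 by
    have := sub_eq_zero.1 (congrFun hf h)
    convert this
  refine eq_zero_of_sum_mul_irr_eq_zero (fun x y hxy => ?_) fun ψ => ?_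
  · have h1 : IsConj g x ↔ IsConj g y := ⟨fun h => h.trans hxy, fun h => h.trans hxy.symm⟩
    simp only [f, h1, Irr.apply_eq_of_isConj _ hxy]
  · have h1 : ∑ x, (∑ χ : Irr G, χ g * starRingEnd ℂ (χ x)) * ψ x = Nat.card G * ψ g := by
      simp only [Finset.sum_mul]
      rw [Finset.sum_comm]
      simp only [mul_assoc, ← Finset.mul_sum, mul_comm (starRingEnd ℂ _), Irr.sum_mul_conj]
      simp [mul_comm]
    have h2 : ∑ x, (if IsConj g x then (Nat.card G : ℂ) else 0) * ψ x =
        Nat.card (ConjClasses.mk g).carrier * (Nat.card G * ψ g) := by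
      have hcard : Nat.card (ConjClasses.mk g).carrier =
          (Finset.univ.filter fun x => IsConj g x).card := by
        rw [Nat.card_eq_fintype_card, Fintype.card_subtype]
        congr 2
      simp only [ite_mul, zero_mul]
      rw [← Finset.sum_filter, hcard, ← nsmul_eq_mul]
      refine Finset.sum_eq_card_nsmul fun x hx => ?_
      rw [Irr.apply_eq_of_isConj ψ (Finset.mem_filter.1 hx).2]
    simp only [f, sub_mul, Finset.sum_sub_distrib, mul_assoc, ← Finset.mul_sum, h1, h2, sub_self]

/-! ### Characters of a finite abelian group -/

/-- Column orthogonality for the characters of a finite abelian group. Commutativity is a hypothesis,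
so that the lemma applies to the group structure that `G ⧸ N` already carries. -/
theorem sum_dual_apply {Q : Type*} [Group Q] [Finite Q] [Fintype (Q →* ℂˣ)]
    (hQ : ∀ x y : Q, x * y = y * x) (x : Q) [Decidable (x = 1)] :
    ∑ χ : Q →* ℂˣ, (χ x : ℂ) = if x = 1 then (Nat.card Q : ℂ) else 0 := by
  let _ : CommGroup Q := { ‹Group Q› with mul_comm := hQ }
  split_ifs with hx
  · rw [← CommGroup.card_monoidHom_of_hasEnoughRootsOfUnity Q ℂ, Nat.card_eq_fintype_card]
    simp [hx]
  · obtain ⟨ψ, hψ⟩ := CommGroup.exists_apply_ne_one_of_hasEnoughRootsOfUnity Q ℂ hx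
    have h : (ψ x : ℂ) * ∑ χ : Q →* ℂˣ, (χ x : ℂ) = ∑ χ : Q →* ℂˣ, (χ x : ℂ) := by
      rw [Finset.mul_sum]
      exact Fintype.sum_equiv (Equiv.mulLeft ψ) _ _ fun χ => by simp
    have h1 : ((ψ x : ℂ) - 1) * ∑ χ : Q →* ℂˣ, (χ x : ℂ) = 0 := by
      rw [sub_mul, h, one_mul, sub_self]
    refine (mul_eq_zero.1 h1).resolve_left fun h2 => hψ (Units.ext ?_)
    simpa using sub_eq_zero.1 h2

theorem card_dual {Q : Type*} [Group Q] [Finite Q] (hQ : ∀ x y : Q, x * y = y * x) :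
    Nat.card (Q →* ℂˣ) = Nat.card Q := by
  let _ : CommGroup Q := { ‹Group Q› with mul_comm := hQ }
  exact CommGroup.card_monoidHom_of_hasEnoughRootsOfUnity Q ℂ

theorem dual_apply_mul_conj {Q : Type*} [Group Q] [Finite Q] (χ : Q →* ℂˣ) (x : Q) :
    (χ x : ℂ) * starRingEnd ℂ (χ x) = 1 := by
  have h : ‖(χ x : ℂ)‖ = 1 := by
    refine Complex.norm_eq_one_of_pow_eq_one (n := Nat.card Q) ?_ Nat.card_pos.ne'
    rw [← Units.val_pow_eq_pow_val, ← map_pow, pow_card_eq_one', map_one, Units.val_one]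
  rw [Complex.mul_conj, Complex.normSq_eq_norm_sq, h]
  simp

/-! ### Sums over a coset -/

/-- A function that is constant on disjoint sets `S j`, and zero outside them, is summed by taking one
representative from each set. Used both for conjugacy classes in `G` and for orbits in `Irr G`. -/
theorem sum_card_mul_apply_eq_sum {J X : Type*} [Fintype J] [Fintype X] (S : J → Set X)
    (r : J → X) (F : X → ℂ) (hS : ∀ i j x, x ∈ S i → x ∈ S j → i = j)
    (hF : ∀ j, ∀ x ∈ S j, F x = F (r j)) (h0 : ∀ x, F x ≠ 0 → ∃ j, x ∈ S j) :
    ∑ j, (Nat.card (S j) : ℂ) * F (r j) = ∑ x, F x := by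
  classical
  have h1 : ∀ j, (Nat.card (S j) : ℂ) * F (r j) = ∑ x, if x ∈ S j then F x else 0 := by
    intro j
    rw [← Finset.sum_filter, Finset.sum_congr rfl fun x hx => hF j x (Finset.mem_filter.1 hx).2,
      Finset.sum_const, nsmul_eq_mul, Nat.card_eq_fintype_card, Fintype.card_subtype]
  rw [Finset.sum_congr rfl fun j _ => h1 j, Finset.sum_comm]
  refine Finset.sum_congr rfl fun x _ => ?_
  by_cases hx : F x = 0
  · simp [hx]
  · obtain ⟨j, hj⟩ := h0 x hx
    rw [Finset.sum_eq_single j (fun i _ hij => if_neg fun hi => hij (hS i j x hi hj)) (by simp),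
      if_pos hj]

theorem mem_leftCoset_iff_mk_eq {G : Type*} [Group G] (N : Subgroup G) (q g : G) :
    g ∈ q • (N : Set G) ↔ (g : G ⧸ N) = q := by
  rw [mem_leftCoset_iff, eq_comm, QuotientGroup.eq, SetLike.mem_coe]

section
variable {G : Type*} [Group G] (N : Subgroup G) [N.Normal]

theorem twist_apply (χ : DualQuotient N) (ρ : Irr G) (g : G) :
    (χ • ρ) g = (χ (g : G ⧸ N) : ℂ) * ρ g := rfl

theorem mk_eq_of_isConj (hQ : ∀ x y : G ⧸ N, x * y = y * x) {g h : G} (hgh : IsConj g h) :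
    (g : G ⧸ N) = h := by
  obtain ⟨c, rfl⟩ := isConj_iff.1 hgh
  rw [QuotientGroup.mk_mul, QuotientGroup.mk_mul, QuotientGroup.mk_inv, hQ c, mul_inv_cancel_right]

/-- The inner product of `ρ` and `σ` over a coset of `N`, computed by Fourier inversion on `G ⧸ N`
and the first orthogonality relation. -/
theorem sum_coset_mul_conj [Fintype G] [Fintype (DualQuotient N)] [DecidableEq (G ⧸ N)]
    [DecidableEq (Irr G)]
    (hQ : ∀ x y : G ⧸ N, x * y = y * x) (q : G) (ρ σ : Irr G) :
    (Nat.card (G ⧸ N) : ℂ) *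
        ∑ g : G, (if (g : G ⧸ N) = q then ρ g * starRingEnd ℂ (σ g) else 0) =
      Nat.card G * ∑ χ : DualQuotient N, if χ • ρ = σ then ((χ q : ℂˣ) : ℂ)⁻¹ else 0 := by
  have h1 : ∀ g : G, (Nat.card (G ⧸ N) : ℂ) *
      (if (g : G ⧸ N) = q then ρ g * starRingEnd ℂ (σ g) else 0) =
      ∑ χ : DualQuotient N, ((χ q : ℂˣ) : ℂ)⁻¹ * ((χ • ρ) g * starRingEnd ℂ (σ g)) := by
    intro g
    have h2 := sum_dual_apply hQ ((q : G ⧸ N)⁻¹ * g)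
    have h3 : (q : G ⧸ N)⁻¹ * g = 1 ↔ (g : G ⧸ N) = q := by rw [inv_mul_eq_one, eq_comm]
    simp only [h3] at h2
    have h4 : ∀ χ : DualQuotient N, ((χ q : ℂˣ) : ℂ)⁻¹ * ((χ • ρ) g * starRingEnd ℂ (σ g)) =
        (χ ((q : G ⧸ N)⁻¹ * g) : ℂ) * (ρ g * starRingEnd ℂ (σ g)) := by
      intro χ
      rw [twist_apply, map_mul, map_inv, Units.val_mul, Units.val_inv_eq_inv_val]
      ring
    rw [Finset.sum_congr rfl fun χ _ => h4 χ, ← Finset.sum_mul, h2]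
    split_ifs <;> simp
  rw [Finset.mul_sum, Finset.sum_congr rfl fun g _ => h1 g, Finset.sum_comm, Finset.mul_sum]
  refine Finset.sum_congr rfl fun χ _ => ?_
  rw [← Finset.mul_sum, Irr.sum_mul_conj]
  split_ifs <;> simp [mul_comm]

/-- Characters in different twist orbits are orthogonal on every coset of `N`. -/
theorem sum_coset_mul_conj_eq_zero [Fintype G] [DecidableEq (G ⧸ N)]
    (hQ : ∀ x y : G ⧸ N, x * y = y * x) (q : G) {ρ σ : Irr G}
    (h : ∀ χ : DualQuotient N, χ • ρ ≠ σ) :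
    ∑ g : G, (if (g : G ⧸ N) = q then ρ g * starRingEnd ℂ (σ g) else 0) = 0 := by
  classical
  have := Fintype.ofFinite (DualQuotient N)
  have h1 := sum_coset_mul_conj N hQ q ρ σ
  have hc : (Nat.card (G ⧸ N) : ℂ) ≠ 0 := Nat.cast_ne_zero.2 Nat.card_pos.ne'
  simpa [h, hc] using h1

/-- The squared norm over a coset of a character that does not vanish there is `#G / #[ρ]`. -/
theorem card_orbit_mul_sum_coset [Fintype G] [DecidableEq (G ⧸ N)]
    (hQ : ∀ x y : G ⧸ N, x * y = y * x) (q : G) {ρ : Irr G} {g₀ : G} (hg₀ : (g₀ : G ⧸ N) = q)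
    (hρ : ρ g₀ ≠ 0) :
    (Nat.card (MulAction.orbit (DualQuotient N) ρ) : ℂ) *
      ∑ g : G, (if (g : G ⧸ N) = q then ρ g * starRingEnd ℂ (ρ g) else 0) = Nat.card G := by
  classical
  have := Fintype.ofFinite (DualQuotient N)
  have h1 := sum_coset_mul_conj N hQ q ρ ρ
  have hc : (Nat.card (G ⧸ N) : ℂ) ≠ 0 := Nat.cast_ne_zero.2 Nat.card_pos.ne'
  -- Compare the values of `χ • ρ = ρ` at a point of the coset where `ρ` does not vanish.
  have h2 : ∀ χ : DualQuotient N, χ • ρ = ρ → (χ q : ℂˣ) = 1 := by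
    intro χ hχ
    have h3 : (χ • ρ) g₀ = ρ g₀ := by rw [hχ]
    rw [twist_apply, mul_eq_right₀ hρ, hg₀] at h3
    exact Units.ext h3
  have h4 : ∑ χ : DualQuotient N, (if χ • ρ = ρ then ((χ q : ℂˣ) : ℂ)⁻¹ else 0) =
      Nat.card (MulAction.stabilizer (DualQuotient N) ρ) := by
    rw [Nat.card_eq_fintype_card, Fintype.card_subtype, ← Finset.sum_boole]
    refine Finset.sum_congr rfl fun χ _ => ?_
    by_cases hχ : χ • ρ = ρ
    · simp [hχ, h2 χ hχ]
    · simp [hχ]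
  have h5 : Nat.card (MulAction.orbit (DualQuotient N) ρ) *
      Nat.card (MulAction.stabilizer (DualQuotient N) ρ) = Nat.card (G ⧸ N) := by
    rw [← card_dual hQ, ← Nat.card_prod]
    exact Nat.card_congr (MulAction.orbitProdStabilizerEquivGroup (DualQuotient N) ρ)
  rw [h4] at h1
  refine mul_left_cancel₀ hc ?_
  rw [mul_left_comm, h1, ← h5]
  push_cast
  ring

theorem twist_apply_mul_conj [Finite G] (χ : DualQuotient N) (ρ : Irr G) {g h : G}
    (hgh : (g : G ⧸ N) = h) :
    (χ • ρ) g * starRingEnd ℂ ((χ • ρ) h) = ρ g * starRingEnd ℂ (ρ h) := by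
  rw [twist_apply, twist_apply, hgh, map_mul, mul_mul_mul_comm, dual_apply_mul_conj, one_mul]

theorem sum_classes_eq_sum_coset [Fintype G] [DecidableEq (G ⧸ N)]
    (hQ : ∀ x y : G ⧸ N, x * y = y * x) (q : G) {f : G → ℂ}
    (hf : ∀ g h, IsConj g h → f g = f h)
    {g : ClassesIn N q → G} (hg : ∀ c, g c ∈ c.1.carrier) :
    ∑ c, (Nat.card c.1.carrier : ℂ) * f (g c) =
      ∑ x : G, if (x : G ⧸ N) = q then f x else 0 := by
  have hmem : ∀ (c : ClassesIn N q) (x : G), x ∈ c.1.carrier → (x : G ⧸ N) = q :=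
    fun c x hx => (mem_leftCoset_iff_mk_eq N q x).1 (c.2 hx)
  have hconj : ∀ (c : ClassesIn N q) (x : G), x ∈ c.1.carrier → IsConj x (g c) := by
    intro c x hx
    have h1 := hg c
    rw [ConjClasses.mem_carrier_iff_mk_eq] at hx h1
    exact ConjClasses.mk_eq_mk_iff_isConj.1 (hx.trans h1.symm)
  rw [← sum_card_mul_apply_eq_sum (fun c : ClassesIn N q => c.1.carrier) g
    (fun x => if (x : G ⧸ N) = q then f x else 0)]
  · refine Finset.sum_congr rfl fun c _ => ?_
    rw [if_pos (hmem c _ (hg c))]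
  · intro c d x hc hd
    rw [ConjClasses.mem_carrier_iff_mk_eq] at hc hd
    exact Subtype.ext (hc.symm.trans hd)
  · intro c x hx
    simp only [hmem c x hx, hmem c _ (hg c), hf _ _ (hconj c x hx)]
  · intro x hx
    have hxq : (x : G ⧸ N) = q := by
      by_contra h
      exact hx (if_neg h)
    refine ⟨⟨ConjClasses.mk x, fun y hy => ?_⟩, ConjClasses.mem_carrier_mk⟩
    rw [ConjClasses.mem_carrier_iff_mk_eq, ConjClasses.mk_eq_mk_iff_isConj] at hy
    rw [mem_leftCoset_iff_mk_eq, mk_eq_of_isConj N hQ hy, hxq]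

theorem sum_orbits_eq_sum_irr [Finite G] [Fintype (Irr G)] (q : G)
    {ρ : OrbitsOn N q → Irr G} (hρ : ∀ o, ρ o ∈ o.1.orbit) {g h : G}
    (hg : (g : G ⧸ N) = q) (hh : (h : G ⧸ N) = q) :
    ∑ o, (Nat.card o.1.orbit : ℂ) * (ρ o g * starRingEnd ℂ (ρ o h)) =
      ∑ χ : Irr G, χ g * starRingEnd ℂ (χ h) := by
  refine sum_card_mul_apply_eq_sum (fun o : OrbitsOn N q => o.1.orbit) ρ
    (fun χ => χ g * starRingEnd ℂ (χ h)) ?_ ?_ ?_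
  · intro o p χ ho hp
    rw [MulAction.orbitRel.Quotient.mem_orbit] at ho hp
    exact Subtype.ext (ho.symm.trans hp)
  · intro o χ hχ
    have h1 := hρ o
    rw [MulAction.orbitRel.Quotient.mem_orbit] at h1 hχ
    obtain ⟨ψ, rfl⟩ := Quotient.exact (hχ.trans h1.symm)
    exact twist_apply_mul_conj N ψ _ (hg.trans hh.symm)
  · intro χ hχ
    refine ⟨⟨Quotient.mk'' χ, χ, ?_, g, (mem_leftCoset_iff_mk_eq N q g).2 hg,
      left_ne_zero_of_mul hχ⟩, ?_⟩ <;> exact MulAction.orbitRel.Quotient.mem_orbit.2 rfl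

/-! ### The coset matrix -/

theorem cosetMatrix_apply_eq_sqrt_card_carrier [Finite G] (q : G) (ρ : OrbitsOn N q → Irr G)
    (g : ClassesIn N q → G) (o : OrbitsOn N q) (c : ClassesIn N q) :
    cosetMatrix N q ρ g o c = (Real.sqrt (Nat.card c.1.carrier) : ℂ) *
      (Real.sqrt (Nat.card o.1.orbit / Nat.card G : ℝ) : ℂ) * ρ o (g c) := by
  rw [cosetMatrix, Matrix.of_apply, mul_div_assoc, Real.sqrt_mul (Nat.cast_nonneg _),
    Complex.ofReal_mul]

theorem cosetMatrix_apply_eq_sqrt_card_orbit [Finite G] (q : G) (ρ : OrbitsOn N q → Irr G)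
    (g : ClassesIn N q → G) (o : OrbitsOn N q) (c : ClassesIn N q) :
    cosetMatrix N q ρ g o c = (Real.sqrt (Nat.card o.1.orbit) : ℂ) *
      (Real.sqrt (Nat.card c.1.carrier / Nat.card G : ℝ) : ℂ) * ρ o (g c) := by
  rw [cosetMatrix, Matrix.of_apply, mul_comm (Nat.card c.1.carrier : ℝ), mul_div_assoc,
    Real.sqrt_mul (Nat.cast_nonneg _), Complex.ofReal_mul]

theorem ofReal_sqrt_mul_self {x : ℝ} (hx : 0 ≤ x) : (Real.sqrt x : ℂ) * Real.sqrt x = x := by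
  rw [← Complex.ofReal_mul, Real.mul_self_sqrt hx]

theorem cosetMatrix_mul_conjTranspose [Finite G] (q : G) [DecidableEq (OrbitsOn N q)]
    (hQ : ∀ x y : G ⧸ N, x * y = y * x) {ρ : OrbitsOn N q → Irr G}
    {g : ClassesIn N q → G} (hρ : ∀ o, ρ o ∈ o.1.orbit) (hg : ∀ c, g c ∈ c.1.carrier) :
    cosetMatrix N q ρ g * (cosetMatrix N q ρ g)ᴴ = 1 := by
  classical
  have := Fintype.ofFinite G
  have hG : (Nat.card G : ℂ) ≠ 0 := Nat.cast_ne_zero.2 Nat.card_pos.ne'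
  ext o p
  have key : (cosetMatrix N q ρ g * (cosetMatrix N q ρ g)ᴴ) o p =
      (Real.sqrt (Nat.card o.1.orbit / Nat.card G : ℝ) : ℂ) *
      (Real.sqrt (Nat.card p.1.orbit / Nat.card G : ℝ) : ℂ) *
      ∑ x : G, if (x : G ⧸ N) = q then ρ o x * starRingEnd ℂ (ρ p x) else 0 := by
    rw [← sum_classes_eq_sum_coset N hQ q (f := fun x => ρ o x * starRingEnd ℂ (ρ p x))
      (fun x y hxy => by simp only [Irr.apply_eq_of_isConj _ hxy]) hg, Matrix.mul_apply,
      Finset.mul_sum]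
    refine Finset.sum_congr rfl fun c _ => ?_
    have hc := ofReal_sqrt_mul_self (Nat.cast_nonneg (α := ℝ) (Nat.card c.1.carrier))
    rw [Complex.ofReal_natCast] at hc
    rw [Matrix.conjTranspose_apply, cosetMatrix_apply_eq_sqrt_card_carrier,
      cosetMatrix_apply_eq_sqrt_card_carrier, ← hc, ← starRingEnd_apply, map_mul, map_mul,
      Complex.conj_ofReal, Complex.conj_ofReal]
    ring
  have horb : ∀ o : OrbitsOn N q, o.1 = Quotient.mk'' (ρ o) := fun o =>
    (MulAction.orbitRel.Quotient.mem_orbit.1 (hρ o)).symm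
  rw [key]
  by_cases hop : o = p
  · subst hop
    obtain ⟨σ, hσ, x, hx, hσx⟩ := o.2
    rw [mem_leftCoset_iff_mk_eq] at hx
    rw [horb o, MulAction.orbitRel.Quotient.mem_orbit] at hσ
    obtain ⟨ψ, rfl⟩ := Quotient.exact hσ
    have h1 := card_orbit_mul_sum_coset N hQ q hx (right_ne_zero_of_mul hσx)
    rw [ofReal_sqrt_mul_self (by positivity), Matrix.one_apply_eq, horb o,
      MulAction.orbitRel.Quotient.orbit_mk]
    push_cast
    rw [div_mul_eq_mul_div, h1, div_self hG]
  · rw [Matrix.one_apply_ne hop, sum_coset_mul_conj_eq_zero N hQ q, mul_zero]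
    intro χ hχ
    refine hop (Subtype.ext ?_)
    rw [horb o, horb p, ← hχ]
    exact Quotient.sound' ⟨χ⁻¹, inv_smul_smul χ (ρ o)⟩

theorem cosetMatrix_conjTranspose_mul [Finite G] (q : G) [DecidableEq (ClassesIn N q)] {ρ : OrbitsOn N q → Irr G}
    {g : ClassesIn N q → G} (hρ : ∀ o, ρ o ∈ o.1.orbit) (hg : ∀ c, g c ∈ c.1.carrier) :
    (cosetMatrix N q ρ g)ᴴ * cosetMatrix N q ρ g = 1 := by
  classical
  have := Fintype.ofFinite (Irr G)
  have hG : (Nat.card G : ℂ) ≠ 0 := Nat.cast_ne_zero.2 Nat.card_pos.ne'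
  have hcl : ∀ c : ClassesIn N q, ConjClasses.mk (g c) = c.1 := fun c =>
    ConjClasses.mem_carrier_iff_mk_eq.1 (hg c)
  have hgq : ∀ c : ClassesIn N q, (g c : G ⧸ N) = q := fun c =>
    (mem_leftCoset_iff_mk_eq N q _).1 (c.2 (hg c))
  ext c d
  have key : ((cosetMatrix N q ρ g)ᴴ * cosetMatrix N q ρ g) c d =
      (Real.sqrt (Nat.card c.1.carrier / Nat.card G : ℝ) : ℂ) *
      (Real.sqrt (Nat.card d.1.carrier / Nat.card G : ℝ) : ℂ) *
      ∑ χ : Irr G, χ (g d) * starRingEnd ℂ (χ (g c)) := by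
    rw [← sum_orbits_eq_sum_irr N q hρ (hgq d) (hgq c), Matrix.mul_apply, Finset.mul_sum]
    refine Finset.sum_congr rfl fun o _ => ?_
    have ho := ofReal_sqrt_mul_self (Nat.cast_nonneg (α := ℝ) (Nat.card o.1.orbit))
    rw [Complex.ofReal_natCast] at ho
    rw [Matrix.conjTranspose_apply, cosetMatrix_apply_eq_sqrt_card_orbit,
      cosetMatrix_apply_eq_sqrt_card_orbit, ← ho, ← starRingEnd_apply, map_mul, map_mul,
      Complex.conj_ofReal, Complex.conj_ofReal]
    ring
  have h1 := Irr.card_carrier_mul_sum (g d) (g c)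
  rw [hcl d, ← ConjClasses.mk_eq_mk_iff_isConj, hcl d, hcl c] at h1
  rw [key]
  by_cases hcd : c = d
  · subst hcd
    rw [if_pos rfl] at h1
    rw [ofReal_sqrt_mul_self (by positivity), Matrix.one_apply_eq]
    push_cast
    rw [div_mul_eq_mul_div, h1, div_self hG]
  · rw [if_neg fun h => hcd (Subtype.ext h.symm)] at h1
    have hd : (Nat.card d.1.carrier : ℂ) ≠ 0 := by
      have : Nonempty d.1.carrier := ⟨⟨g d, hg d⟩⟩
      exact Nat.cast_ne_zero.2 Nat.card_pos.ne'
    rw [(mul_eq_zero.1 h1).resolve_left hd, mul_zero, Matrix.one_apply_ne hcd]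

end

theorem card_eq_of_mul_eq_one {m n : Type*} [Fintype m] [Fintype n] [DecidableEq m]
    [DecidableEq n] {A : Matrix m n ℂ} {B : Matrix n m ℂ} (hAB : A * B = 1) (hBA : B * A = 1) :
    Fintype.card m = Fintype.card n := by
  have h := Matrix.trace_mul_comm A B
  rw [hAB, hBA, Matrix.trace_one, Matrix.trace_one] at h
  exact_mod_cast h

end CosetCharacters

open scoped Classical in
theorem theorem1 {G : Type*} [Group G] [Finite G] (N : Subgroup G) [N.Normal]
    (hQ : ∀ x y : G ⧸ N, x * y = y * x) (q : G) :
    Nat.card (CosetCharacters.ClassesIn N q) = Nat.card (CosetCharacters.OrbitsOn N q) ∧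
    ∀ (ρ : CosetCharacters.OrbitsOn N q → CosetCharacters.Irr G)
      (g : CosetCharacters.ClassesIn N q → G),
      (∀ o, ρ o ∈ o.1.orbit) → (∀ c, g c ∈ c.1.carrier) →
        CosetCharacters.cosetMatrix N q ρ g * (CosetCharacters.cosetMatrix N q ρ g)ᴴ = 1 ∧
        (CosetCharacters.cosetMatrix N q ρ g)ᴴ * CosetCharacters.cosetMatrix N q ρ g = 1 := by
  have row := fun ρ g => CosetCharacters.cosetMatrix_mul_conjTranspose N q hQ (ρ := ρ) (g := g)
  have col := fun ρ g => CosetCharacters.cosetMatrix_conjTranspose_mul N q (ρ := ρ) (g := g)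
  refine ⟨?_, fun ρ g hρ hg => ⟨row ρ g hρ hg, col ρ g hρ hg⟩⟩
  choose ρ hρ _ using fun o : CosetCharacters.OrbitsOn N q => o.2
  have hne : ∀ c : CosetCharacters.ClassesIn N q, ∃ g, g ∈ c.1.carrier := by
    rintro ⟨c, -⟩
    obtain ⟨g, rfl⟩ := ConjClasses.mk_surjective c
    exact ⟨g, ConjClasses.mem_carrier_mk⟩
  choose g hg using hne
  rw [Nat.card_eq_fintype_card, Nat.card_eq_fintype_card]
  exact CosetCharacters.card_eq_of_mul_eq_one (col ρ g hρ hg) (row ρ g hρ hg)
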